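/- For $k\ge 0$ let $p_k$ be the Legendre polynomial of degree $k$, orthonormal in $L^2(-1,1)$, and let $\Theta(x)=0$ for $x<0$, $\Theta(x)=1$ for $x\ge 0$. For $d\ge 0$ let $B^{(d)}=[b^{(d)}_{k,\ell}]_{k,\ell\ge 0}$ with $$b^{(d)}_{k,\ell}=\int_{-1}^1\int_{-1}^1 p_d(\tau)\,\Theta(\tau-\rho)\,p_k(\tau)\,p_\ell(\rho)\,d\rho\,d\tau .$$ Let $\tilde f:[-1,1]\to\mathbb C$ be analytic, with Legendre coefficients $\alpha_d=\int_{-1}^1\tilde f(t)\,p_d(t)\,dt$. For $N\ge 0$ let $F^{(N)}=\sum_{d=0}^N\alpha_d B^{(d)}$ (an $(N+1)$-banded infinite matrix), and let $F^{(N)}_M$ be its $M\times M$ leading principal submatrix. For a matrix $A\in\mathbb C^{M\times M}$ write $W(A)=\{v^HAv : v\in\mathbb C^M,\ \|v\|_2=1\}$. Let $\mathcal H$ be a complex Hilbert space with orthonormal basis $\{\dot e_0,\dot e_1,\dots\}$, let $\mathcal H_M$ be the span of $\dot e_0,\dots,\dot e_{M-1}$, and let $\mathcal P_M$ be the orthogonal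 projection onto $\mathcal H_M$. **Theorem.** Assume that there are $r<1$ and $M_0$ such that $W(F^{(N)}_M)$ is contained in the closed disk $D(0,r)=\{z\in\mathbb C:|z|\le r\}$ for every $M>M_0$. Then there is a unique bounded operator $\mathcal R:\mathcal H\to\mathcal H$ represented by the banded matrix $I-F^{(N)}=[a_{k,\ell}]$, that is, with $$\mathcal R\,\dot e_\ell=\sum_{k=\max\{\ell-N-1,0\}}^{\ell+N+1}a_{k,\ell}\,\dot e_k\qquad(\ell\ge 0),$$ and $\mathcal R$ is invertible, with bounded inverse. Moreover, put $\mathcal R_M=\mathcal P_M\mathcal R\mathcal P_M$ and let $\mathcal R x=y$. Then for every $M>M_0$ the equation $\mathcal R_M x_M=\mathcal P_M y$ has exactly one solution $x_M\in\mathcal H_M$, and $\|x_M-x\|\to 0$ as $M\to\infty$. -/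

import Mathlib

noncomputable section

open scoped Polynomial

namespace LegendreStar

/-- The classical Legendre polynomial of degree `k`, by Rodrigues' formula. -/
def legendre (k : ℕ) : ℝ[X] :=
  Polynomial.C (1 / (2 ^ k * (k.factorial : ℝ))) *
    Polynomial.derivative^[k] ((Polynomial.X ^ 2 - 1) ^ k)

/-- The Legendre polynomial of degree `k`, orthonormal in `L²(-1, 1)`. -/
def orthoLegendre (k : ℕ) (t : ℝ) : ℝ :=
  Real.sqrt ((2 * (k : ℝ) + 1) / 2) * (legendre k).eval t

/-- The Heaviside function, with value `1` at `0`. -/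
def heaviside (x : ℝ) : ℝ := if x < 0 then 0 else 1

/-- The infinite matrix of the Legendre coefficients of a bivariate function on `[-1, 1]²`. -/
def coeffMatrix (g : ℝ → ℝ → ℂ) : Matrix ℕ ℕ ℂ := fun k l =>
  ∫ τ in (-1 : ℝ)..1, ∫ ρ in (-1 : ℝ)..1,
    g τ ρ * (orthoLegendre k τ : ℂ) * (orthoLegendre l ρ : ℂ)

/-- The Legendre basis matrix: the coefficient matrix of `p_d(t) Θ(t - s)`. -/
def basisMatrix (d : ℕ) : Matrix ℕ ℕ ℂ :=
  coeffMatrix fun t s => (orthoLegendre d t : ℂ) * (heaviside (t - s) : ℂ)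

/-- The `d`-th Legendre coefficient of a function on `[-1, 1]`. -/
def legendreCoeff (f : ℝ → ℂ) (d : ℕ) : ℂ :=
  ∫ t in (-1 : ℝ)..1, f t * (orthoLegendre d t : ℂ)

/-- The matrix `F^(N) = ∑_{d ≤ N} α_d B^(d)` of the function `f`. -/
def bandedCoeffMatrix (f : ℝ → ℂ) (N : ℕ) : Matrix ℕ ℕ ℂ :=
  ∑ d ∈ Finset.range (N + 1), legendreCoeff f d • basisMatrix d

/-- The `M × M` leading principal submatrix. -/
def finiteSection (A : Matrix ℕ ℕ ℂ) (M : ℕ) : Matrix (Fin M) (Fin M) ℂ :=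
  A.submatrix (fun i => (i : ℕ)) (fun j => (j : ℕ))

/-- The field of values `{vᴴ A v : ‖v‖₂ = 1}`. -/
def fieldOfValues {M : ℕ} (A : Matrix (Fin M) (Fin M) ℂ) : Set ℂ :=
  {z | ∃ v : EuclideanSpace ℂ (Fin M), ‖v‖ = 1 ∧
    z = dotProduct (star (fun i => v i)) (A.mulVec fun i => v i)}

variable {H : Type*} [NormedAddCommGroup H] [InnerProductSpace ℂ H]

/-- The bounded operator `T` acts on the orthonormal basis `e` by
`T e_l = ∑_{k = max(l - w, 0)}^{l + w} a_{k,l} e_k`. -/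
def IsBandedOperator (e : HilbertBasis ℕ ℂ H) (w : ℕ) (A : Matrix ℕ ℕ ℂ) (T : H →L[ℂ] H) : Prop :=
  ∀ l : ℕ, T (e l) = ∑ k ∈ Finset.Icc (l - w) (l + w), A k l • e k

/-- The linear span of `e_0, …, e_{M-1}`. -/
def sectionSpace (e : HilbertBasis ℕ ℂ H) (M : ℕ) : Submodule ℂ H :=
  Submodule.span ℂ (Set.range fun i : Fin M => e i)

instance finiteDimensional_sectionSpace (e : HilbertBasis ℕ ℂ H) (M : ℕ) :
    FiniteDimensional ℂ (sectionSpace e M) :=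
  FiniteDimensional.span_of_finite ℂ (Set.finite_range _)

/-- The orthogonal projection `P_M` onto the span of `e_0, …, e_{M-1}`. -/
def sectionProj (e : HilbertBasis ℕ ℂ H) (M : ℕ) : H →L[ℂ] H :=
  (sectionSpace e M).starProjection

/-- The finite section `T_M = P_M T P_M`. -/
def sectionOperator (e : HilbertBasis ℕ ℂ H) (M : ℕ) (T : H →L[ℂ] H) : H →L[ℂ] H :=
  sectionProj e M ∘L T ∘L sectionProj e M

end LegendreStar

end

/-! Everything rests on the coercivity `(1 - r) * ‖x‖ ^ 2 ≤ re ⟪x, R x⟫`. Given this, `R` is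
invertible by Lax–Milgram, and its finite sections are Galerkin systems: uniquely solvable, and
convergent by Céa's lemma.

For the operator itself, orthogonality to polynomials of lower degree makes `F^(N)` banded, so it
acts on finitely supported vectors. Each such vector lies in some large section, hence the numerical
range on all of them lies in `D(0, r)`. Polarization turns this into a norm bound, density extends
the map to `H`, and continuity carries the estimate for `I - F^(N)` to every `x`. -/

namespace LegendreStar

open scoped Polynomial

/-! ### Bandedness of the Legendre matrices. -/

/-- Every real polynomial has a polynomial antiderivative of degree at most one more. -/
theorem exists_antiderivative (p : ℝ[X]) :
    ∃ q : ℝ[X], Polynomial.derivative q = p ∧ q.natDegree ≤ p.natDegree + 1 := by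
  refine ⟨∑ n ∈ Finset.range (p.natDegree + 1),
    Polynomial.C (p.coeff n / (n + 1)) * Polynomial.X ^ (n + 1), ?_, ?_⟩
  · conv_rhs => rw [p.as_sum_range_C_mul_X_pow]
    rw [Polynomial.derivative_sum]
    refine Finset.sum_congr rfl fun n _ => ?_
    rw [Polynomial.derivative_C_mul_X_pow]
    congr 2
    push_cast
    field_simp
  · refine Polynomial.natDegree_sum_le_of_forall_le _ _ fun n hn => ?_
    refine (Polynomial.natDegree_C_mul_X_pow_le _ _).trans ?_
    have := Finset.mem_range.1 hn
    omega

theorem intervalIntegrable_eval (p : ℝ[X]) (a b : ℝ) :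
    IntervalIntegrable (fun x => p.eval x) MeasureTheory.volume a b :=
  p.continuous.intervalIntegrable a b

theorem integral_eval_derivative (p : ℝ[X]) (a b : ℝ) :
    ∫ x in a..b, (Polynomial.derivative p).eval x = p.eval b - p.eval a :=
  intervalIntegral.integral_eq_sub_of_hasDerivAt (fun x _ => p.hasDerivAt x)
    (intervalIntegrable_eval _ _ _)

theorem integral_eval_mul_eval_derivative (p q : ℝ[X]) (a b : ℝ) :
    ∫ x in a..b, p.eval x * (Polynomial.derivative q).eval x =
      p.eval b * q.eval b - p.eval a * q.eval a -
        ∫ x in a..b, (Polynomial.derivative p).eval x * q.eval x :=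
  intervalIntegral.integral_mul_deriv_eq_deriv_mul (fun x _ => p.hasDerivAt x)
    (fun x _ => q.hasDerivAt x) (intervalIntegrable_eval _ _ _) (intervalIntegrable_eval _ _ _)

/-- A polynomial of degree less than `j` is orthogonal to the `j`-th derivative of
`(x ^ 2 - 1) ^ k`, for `j ≤ k`. -/
theorem integral_eval_mul_iterate_derivative_eq_zero (k j : ℕ) (hj : j ≤ k) (q : ℝ[X])
    (hq : q.degree < j) :
    ∫ x in (-1 : ℝ)..1,
      q.eval x * (Polynomial.derivative^[j] ((Polynomial.X ^ 2 - 1 : ℝ[X]) ^ k)).eval x = 0 := by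
  induction j generalizing q with
  | zero =>
    have : q = 0 := Polynomial.degree_eq_bot.1 (Nat.WithBot.lt_zero_iff.1 (by simpa using hq))
    simp [this]
  | succ j ih =>
    -- A factor `(x ^ 2 - 1) ^ (k - j)` with positive exponent survives differentiation, killing the
    -- boundary terms at `±1`.
    have hroot : ∀ x : ℝ, x ^ 2 - 1 = 0 →
        (Polynomial.derivative^[j] ((Polynomial.X ^ 2 - 1 : ℝ[X]) ^ k)).eval x = 0 := by
      intro x hx
      obtain ⟨g, hg⟩ := Polynomial.pow_sub_dvd_iterate_derivative_pow
        (Polynomial.X ^ 2 - 1 : ℝ[X]) k j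
      rw [hg]
      simp [hx, show k - j ≠ 0 by omega]
    have hdeg : (Polynomial.derivative q).degree < j := by
      by_cases h0 : q.natDegree = 0
      · rw [Polynomial.derivative_of_natDegree_zero h0, Polynomial.degree_zero]
        exact WithBot.bot_lt_coe _
      · have hq0 : q ≠ 0 := by rintro rfl; simp at h0
        have h1 := (Polynomial.degree_derivative_lt hq0)
        rw [Polynomial.degree_eq_natDegree hq0] at h1 hq
        have h2 : q.natDegree < j + 1 := by exact_mod_cast hq
        refine h1.trans_le ?_
        exact_mod_cast Nat.lt_succ_iff.1 h2
    rw [Function.iterate_succ_apply', integral_eval_mul_eval_derivative,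
      ih (by omega) _ hdeg, hroot 1 (by norm_num), hroot (-1) (by norm_num)]
    simp

/-- The polynomial underlying `orthoLegendre`. -/
noncomputable def orthoLegendrePoly (k : ℕ) : ℝ[X] :=
  Polynomial.C (Real.sqrt ((2 * (k : ℝ) + 1) / 2)) * legendre k

theorem orthoLegendre_eq_eval (k : ℕ) (t : ℝ) :
    orthoLegendre k t = (orthoLegendrePoly k).eval t := by
  simp [orthoLegendre, orthoLegendrePoly]

theorem natDegree_orthoLegendrePoly_le (k : ℕ) : (orthoLegendrePoly k).natDegree ≤ k := by
  refine (Polynomial.natDegree_C_mul_le _ _).trans ((Polynomial.natDegree_C_mul_le _ _).trans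
    ((Polynomial.natDegree_iterate_derivative _ _).trans ?_))
  have h : ((Polynomial.X ^ 2 - 1 : ℝ[X]) ^ k).natDegree ≤ k * 2 :=
    Polynomial.natDegree_pow_le_of_le k (by compute_degree)
  omega

theorem integral_eval_mul_orthoLegendrePoly_eq_zero (k : ℕ) (q : ℝ[X]) (hq : q.natDegree < k) :
    ∫ x in (-1 : ℝ)..1, q.eval x * (orthoLegendrePoly k).eval x = 0 := by
  have h := integral_eval_mul_iterate_derivative_eq_zero k k le_rfl q
    (Polynomial.degree_le_natDegree.trans_lt (by exact_mod_cast hq))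
  simp only [orthoLegendrePoly, legendre, Polynomial.eval_mul, Polynomial.eval_C]
  simp_rw [mul_left_comm (Polynomial.eval _ q)]
  rw [intervalIntegral.integral_const_mul, intervalIntegral.integral_const_mul, h]
  simp

theorem integral_heaviside_mul_eval (p : ℝ[X]) (c τ : ℝ) (hτ : τ ∈ Set.Icc (-1 : ℝ) 1) :
    ∫ ρ in (-1 : ℝ)..1, c * (heaviside (τ - ρ) * p.eval ρ) = c * ∫ ρ in (-1 : ℝ)..τ, p.eval ρ := by
  rw [intervalIntegral.integral_const_mul, ← intervalIntegral.integral_indicator hτ]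
  congr 2 with ρ
  -- The value `1` at `0` makes the two integrands agree even at `ρ = τ`.
  by_cases h : ρ ≤ τ
  · simp [heaviside, h, not_lt.2 h]
  · simp [heaviside, h, not_le.1 h]

theorem basisMatrix_eq (d k l : ℕ) : basisMatrix d k l =
    ((∫ τ in (-1 : ℝ)..1, (orthoLegendrePoly d * orthoLegendrePoly k).eval τ *
      ∫ ρ in (-1 : ℝ)..τ, (orthoLegendrePoly l).eval ρ : ℝ) : ℂ) := by
  rw [basisMatrix, coeffMatrix, ← intervalIntegral.integral_ofReal]
  refine intervalIntegral.integral_congr fun τ hτ => ?_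
  rw [Set.uIcc_of_le (by norm_num)] at hτ
  rw [← integral_heaviside_mul_eval _ _ _ hτ, ← intervalIntegral.integral_ofReal]
  congr 1 with ρ
  simp only [orthoLegendre_eq_eval, Polynomial.eval_mul]
  push_cast
  ring

/-- Integrating `p_l` raises the degree by one and multiplying by `p_d` by at most `d`, so `p_k`
meets a polynomial of degree at most `l + d + 1`. -/
theorem basisMatrix_eq_zero_of_lt_row (d k l : ℕ) (h : l + d + 1 < k) :
    basisMatrix d k l = 0 := by
  obtain ⟨Q, hQ, hQd⟩ := exists_antiderivative (orthoLegendrePoly l)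
  have hl := natDegree_orthoLegendrePoly_le l
  have hd := natDegree_orthoLegendrePoly_le d
  rw [basisMatrix_eq, Complex.ofReal_eq_zero, ← hQ]
  simp_rw [integral_eval_derivative]
  rw [← integral_eval_mul_orthoLegendrePoly_eq_zero k
    (orthoLegendrePoly d * (Q - Polynomial.C (Q.eval (-1))))]
  · congr 1 with τ
    simp only [Polynomial.eval_mul, Polynomial.eval_sub, Polynomial.eval_C]
    ring
  · refine Polynomial.natDegree_mul_le.trans_lt ?_
    rw [Polynomial.natDegree_sub_C]
    omega

/-- Here `p_l` has mean zero, so its antiderivative from `-1` vanishes at both ends. Integration by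
parts then pairs `p_l` with an antiderivative of `p_d p_k`, of degree at most `k + d + 1`. -/
theorem basisMatrix_eq_zero_of_lt_col (d k l : ℕ) (h : k + d + 1 < l) :
    basisMatrix d k l = 0 := by
  obtain ⟨Q, hQ, -⟩ := exists_antiderivative (orthoLegendrePoly l)
  obtain ⟨G, hG, hGd⟩ := exists_antiderivative (orthoLegendrePoly d * orthoLegendrePoly k)
  have hk := natDegree_orthoLegendrePoly_le k
  have hd := natDegree_orthoLegendrePoly_le d
  have hmul := Polynomial.natDegree_mul_le (p := orthoLegendrePoly d) (q := orthoLegendrePoly k)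
  have hends : Q.eval 1 - Q.eval (-1) = 0 := by
    rw [← integral_eval_derivative, hQ,
      ← integral_eval_mul_orthoLegendrePoly_eq_zero l 1 (by simp; omega)]
    simp
  have horth := integral_eval_mul_orthoLegendrePoly_eq_zero l G (by omega)
  have hparts := integral_eval_mul_eval_derivative (Q - Polynomial.C (Q.eval (-1))) G (-1) 1
  rw [basisMatrix_eq, Complex.ofReal_eq_zero, ← hQ, ← hG]
  simp_rw [integral_eval_derivative]
  simp only [Polynomial.eval_sub, Polynomial.eval_C, Polynomial.derivative_sub,
    Polynomial.derivative_C, sub_zero, hends, hQ, sub_self, zero_mul, zero_sub] at hparts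
  simp only [mul_comm (Polynomial.eval _ (orthoLegendrePoly l)), horth, neg_zero] at hparts
  rw [← hparts]
  congr 1 with τ
  ring

/-- The matrix `F^(N)` has bandwidth `N + 1`. -/
theorem bandedCoeffMatrix_eq_zero (f : ℝ → ℂ) (N k l : ℕ)
    (h : k ∉ Finset.Icc (l - (N + 1)) (l + (N + 1))) : bandedCoeffMatrix f N k l = 0 := by
  rw [bandedCoeffMatrix, Matrix.sum_apply]
  refine Finset.sum_eq_zero fun d hd => ?_
  have hd := Finset.mem_range.1 hd
  rw [Finset.mem_Icc, not_and_or] at h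
  rw [Matrix.smul_apply]
  rcases h with h | h
  · rw [basisMatrix_eq_zero_of_lt_col d k l (by omega), smul_zero]
  · rw [basisMatrix_eq_zero_of_lt_row d k l (by omega), smul_zero]

/-! ### Numerical range and norm bounds on finitely supported vectors. -/

open scoped InnerProductSpace

theorem norm_dotProduct_mulVec_le {M : ℕ} (A : Matrix (Fin M) (Fin M) ℂ) (r : ℝ)
    (hA : fieldOfValues A ⊆ Metric.closedBall 0 r) (v : EuclideanSpace ℂ (Fin M)) :
    ‖dotProduct (star (fun i => v i)) (A.mulVec fun i => v i)‖ ≤ r * ‖v‖ ^ 2 := by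
  by_cases hv : v = 0
  · simp [hv, dotProduct]
  have hn : ‖v‖ ≠ 0 := norm_ne_zero_iff.2 hv
  let w : EuclideanSpace ℂ (Fin M) := ((‖v‖ : ℂ)⁻¹) • v
  have hw : ‖w‖ = 1 := by simp [w, norm_smul, hn]
  have hvw : (fun i => v i) = (‖v‖ : ℂ) • (fun i => w i) := by
    ext i
    simp [w, hn]
  have h := hA ⟨w, hw, rfl⟩
  rw [mem_closedBall_zero_iff] at h
  rw [hvw, Matrix.mulVec_smul, star_smul, smul_dotProduct, dotProduct_smul]
  simp only [smul_eq_mul, norm_mul, Complex.star_def, Complex.conj_ofReal, Complex.norm_real,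
    norm_norm]
  nlinarith [sq_nonneg ‖v‖]

variable {H : Type*} [NormedAddCommGroup H] [InnerProductSpace ℂ H]

/-- A linear map whose matrix has field of values in `D(0, r)` has numerical range in `D(0, r)`
on the span of finitely many basis vectors. -/
theorem norm_inner_le_of_fieldOfValues (e : HilbertBasis ℕ ℂ H) (A : Matrix ℕ ℕ ℂ)
    (g : (ℕ →₀ ℂ) →ₗ[ℂ] H) (hg : ∀ k l, ⟪e k, g (Finsupp.single l 1)⟫_ℂ = A k l) (r : ℝ) (M : ℕ)
    (hA : fieldOfValues (finiteSection A M) ⊆ Metric.closedBall 0 r) (v : ℕ →₀ ℂ)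
    (hv : v.support ⊆ Finset.range M) :
    ‖⟪Finsupp.linearCombination ℂ e v, g v⟫_ℂ‖ ≤ r * ‖Finsupp.linearCombination ℂ e v‖ ^ 2 := by
  have hJ : Finsupp.linearCombination ℂ e v = ∑ i : Fin M, v i • e i := by
    rw [Finsupp.linearCombination_apply, Finsupp.sum_of_support_subset v hv _ (by simp),
      Finset.sum_range]
  have hgv : g v = ∑ i : Fin M, v i • g (Finsupp.single i 1) := by
    conv_lhs => rw [← Finsupp.sum_single v]
    rw [Finsupp.sum_of_support_subset v hv _ (by simp), Finset.sum_range, map_sum]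
    refine Finset.sum_congr rfl fun i _ => ?_
    rw [← map_smul, Finsupp.smul_single_one]
  have hinner : ⟪Finsupp.linearCombination ℂ e v, g v⟫_ℂ =
      dotProduct (star fun i : Fin M => v i)
        ((finiteSection A M).mulVec fun i : Fin M => v i) := by
    rw [hJ, hgv, sum_inner]
    simp only [dotProduct, Matrix.mulVec]
    refine Finset.sum_congr rfl fun i _ => ?_
    rw [inner_smul_left, inner_sum]
    congr 1
    refine Finset.sum_congr rfl fun j _ => ?_
    rw [inner_smul_right, hg, mul_comm]
    rfl
  have hnorm : ‖Finsupp.linearCombination ℂ e v‖ ^ 2 =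
      ‖(WithLp.toLp 2 fun i : Fin M => v i : EuclideanSpace ℂ (Fin M))‖ ^ 2 := by
    have he : Orthonormal ℂ (fun i : Fin M => e i) := e.orthonormal.comp _ Fin.val_injective
    rw [EuclideanSpace.norm_sq_eq, hJ, norm_sq_eq_re_inner (𝕜 := ℂ), he.inner_sum, map_sum]
    refine Finset.sum_congr rfl fun i _ => ?_
    rw [Complex.conj_mul', ← Complex.ofReal_pow]
    exact Complex.ofReal_re _
  rw [hinner, hnorm]
  exact norm_dotProduct_mulVec_le (finiteSection A M) r hA (WithLp.toLp 2 fun i : Fin M => v i)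

/-- A numerical radius bound gives a norm bound, when the range of `g` lies in that of `J`. -/
theorem norm_le_two_mul_of_norm_inner_le {E : Type*} [AddCommGroup E] [Module ℂ E]
    (J g : E →ₗ[ℂ] H) (hJ : ∀ v, ∃ u, J u = g v)
    (h : ∀ v, ‖⟪J v, g v⟫_ℂ‖ ≤ ‖J v‖ ^ 2) (v : E) : ‖g v‖ ≤ 2 * ‖J v‖ := by
  have key : ∀ u v, ‖⟪J u, g v⟫_ℂ‖ ≤ ‖J u‖ ^ 2 + ‖J v‖ ^ 2 := by
    intro u v
    -- Polarization; the parallelogram law then sums the four squared norms to `4 * (‖J u‖ ^ 2 + ‖J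
    -- v‖ ^ 2)`.
    have hpol : 4 * ⟪J u, g v⟫_ℂ = ⟪J (u + v), g (u + v)⟫_ℂ - ⟪J (u - v), g (u - v)⟫_ℂ
        - Complex.I * ⟪J (u + Complex.I • v), g (u + Complex.I • v)⟫_ℂ
        + Complex.I * ⟪J (u - Complex.I • v), g (u - Complex.I • v)⟫_ℂ := by
      simp only [map_add, map_sub, map_smul, inner_add_left, inner_add_right, inner_sub_left,
        inner_sub_right, inner_smul_left, inner_smul_right, Complex.conj_I]
      linear_combination (2 * ⟪J u, g v⟫_ℂ - 2 * ⟪J v, g u⟫_ℂ) * Complex.I_sq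
    have hI : ‖J (Complex.I • v)‖ = ‖J v‖ := by rw [map_smul, norm_smul, Complex.norm_I, one_mul]
    have hp : ∀ w, ‖J (u + w)‖ ^ 2 + ‖J (u - w)‖ ^ 2 = 2 * (‖J u‖ ^ 2 + ‖J w‖ ^ 2) := by
      intro w
      have := parallelogram_law_with_norm ℂ (J u) (J w)
      rw [map_add, map_sub]
      nlinarith
    have h1 := hp v
    have h2 := hp (Complex.I • v)
    rw [hI] at h2
    have h3 : ‖4 * ⟪J u, g v⟫_ℂ‖ ≤ ‖J (u + v)‖ ^ 2 + ‖J (u - v)‖ ^ 2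
        + ‖J (u + Complex.I • v)‖ ^ 2 + ‖J (u - Complex.I • v)‖ ^ 2 := by
      rw [hpol]
      refine (norm_add_le _ _).trans (add_le_add ((norm_sub_le _ _).trans
        (add_le_add ((norm_sub_le _ _).trans (add_le_add (h _) (h _))) ?_)) ?_)
      · rw [norm_mul, Complex.norm_I, one_mul]
        exact h _
      · rw [norm_mul, Complex.norm_I, one_mul]
        exact h _
    rw [norm_mul, Complex.norm_ofNat] at h3
    linarith
  obtain ⟨u, hu⟩ := hJ v
  -- Testing against `g v / 2` gives `‖g v‖ ^ 2 / 2 ≤ ‖g v‖ ^ 2 / 4 + ‖J v‖ ^ 2`.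
  have h4 := key ((1 / 2 : ℂ) • u) v
  rw [map_smul, hu, inner_smul_left, inner_self_eq_norm_sq_to_K, norm_smul] at h4
  have h5 : 1 / 2 * ‖g v‖ ^ 2 ≤ (1 / 2 * ‖g v‖) ^ 2 + ‖J v‖ ^ 2 := by
    simpa using h4
  refine abs_le_of_sq_le_sq' ?_ (by positivity) |>.2
  nlinarith

/-- The numerical range bound on all finitely supported vectors, from eventual bounds on finite
sections. -/
theorem norm_inner_le_of_forall_fieldOfValues (e : HilbertBasis ℕ ℂ H) (A : Matrix ℕ ℕ ℂ)
    (g : (ℕ →₀ ℂ) →ₗ[ℂ] H) (hg : ∀ k l, ⟪e k, g (Finsupp.single l 1)⟫_ℂ = A k l) (r : ℝ) (M₀ : ℕ)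
    (hA : ∀ M > M₀, fieldOfValues (finiteSection A M) ⊆ Metric.closedBall 0 r) (v : ℕ →₀ ℂ) :
    ‖⟪Finsupp.linearCombination ℂ e v, g v⟫_ℂ‖ ≤ r * ‖Finsupp.linearCombination ℂ e v‖ ^ 2 := by
  obtain ⟨n, hn⟩ := v.support.exists_nat_subset_range
  exact norm_inner_le_of_fieldOfValues e A g hg r _ (hA (max n (M₀ + 1)) (by omega)) v
    (hn.trans (Finset.range_subset_range.2 (le_max_left _ _)))

/-! ### The represented operator: existence, uniqueness, coercivity. -/

theorem denseRange_linearCombination (e : HilbertBasis ℕ ℂ H) :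
    DenseRange (Finsupp.linearCombination ℂ e) := by
  rw [DenseRange, ← LinearMap.coe_range, Finsupp.range_linearCombination,
    Submodule.dense_iff_topologicalClosure_eq_top]
  exact e.dense_span

theorem inner_sum_smul_of_banded (e : HilbertBasis ℕ ℂ H) (w : ℕ) (A : Matrix ℕ ℕ ℂ)
    (hA : ∀ k l, k ∉ Finset.Icc (l - w) (l + w) → A k l = 0) (k l : ℕ) :
    ⟪e k, ∑ j ∈ Finset.Icc (l - w) (l + w), A j l • e j⟫_ℂ = A k l := by
  simp only [inner_sum, inner_smul_right, orthonormal_iff_ite.1 e.orthonormal, mul_ite, mul_one, mul_zero,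
    Finset.sum_ite_eq]
  split_ifs with h
  · rfl
  · exact (hA k l h).symm

theorem IsBandedOperator.unique {e : HilbertBasis ℕ ℂ H} {w : ℕ} {A : Matrix ℕ ℕ ℂ}
    {R S : H →L[ℂ] H} (hR : IsBandedOperator e w A R) (hS : IsBandedOperator e w A S) : R = S := by
  refine ContinuousLinearMap.ext_on (s := Set.range e) ?_ ?_
  · exact Submodule.dense_iff_topologicalClosure_eq_top.2 e.dense_span
  · rintro _ ⟨l, rfl⟩
    rw [hR l, hS l]

/-- A banded matrix whose finite sections eventually have numerical radius at most `1` represents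
a bounded operator. -/
theorem exists_isBandedOperator [CompleteSpace H] (e : HilbertBasis ℕ ℂ H) (w : ℕ)
    (A : Matrix ℕ ℕ ℂ) (hA : ∀ k l, k ∉ Finset.Icc (l - w) (l + w) → A k l = 0) (M₀ : ℕ)
    (hW : ∀ M > M₀, fieldOfValues (finiteSection A M) ⊆ Metric.closedBall 0 1) :
    ∃ T : H →L[ℂ] H, IsBandedOperator e w A T := by
  let J := Finsupp.linearCombination ℂ e
  let g : (ℕ →₀ ℂ) →ₗ[ℂ] H := Finsupp.linearCombination ℂ fun l =>
    ∑ k ∈ Finset.Icc (l - w) (l + w), A k l • e k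
  have hgs : ∀ l, g (Finsupp.single l 1) = ∑ k ∈ Finset.Icc (l - w) (l + w), A k l • e k := by
    intro l
    simp [g]
  have hrange : ∀ v, ∃ u, J u = g v := by
    intro v
    have hle : LinearMap.range g ≤ LinearMap.range J := by
      rw [Finsupp.range_linearCombination, Submodule.span_le, Finsupp.range_linearCombination]
      rintro _ ⟨l, rfl⟩
      exact Submodule.sum_mem _ fun k _ =>
        Submodule.smul_mem _ _ (Submodule.subset_span ⟨k, rfl⟩)
    exact hle ⟨v, rfl⟩
  have hbound : ∀ v, ‖g v‖ ≤ 2 * ‖J v‖ :=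
    norm_le_two_mul_of_norm_inner_le J g hrange fun v => by
      simpa using norm_inner_le_of_forall_fieldOfValues e A g
        (fun k l => by rw [hgs, inner_sum_smul_of_banded e w A hA]) 1 M₀ hW v
  refine ⟨g.extendOfNorm J, fun l => ?_⟩
  rw [← hgs, ← LinearMap.extendOfNorm_eq (denseRange_linearCombination e) ⟨2, hbound⟩]
  simp [J]

/-- The operator represented by `1 - A` is coercive. -/
theorem IsBandedOperator.le_re_inner {e : HilbertBasis ℕ ℂ H} {w : ℕ} {A : Matrix ℕ ℕ ℂ}
    {R : H →L[ℂ] H} (hR : IsBandedOperator e w (1 - A) R)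
    (hA : ∀ k l, k ∉ Finset.Icc (l - w) (l + w) → A k l = 0) {r : ℝ} {M₀ : ℕ}
    (hW : ∀ M > M₀, fieldOfValues (finiteSection A M) ⊆ Metric.closedBall 0 r) (x : H) :
    (1 - r) * ‖x‖ ^ 2 ≤ (⟪x, R x⟫_ℂ).re := by
  have hbanded : ∀ k l, k ∉ Finset.Icc (l - w) (l + w) → (1 - A) k l = 0 := by
    intro k l h
    have hkl : k ≠ l := by
      rintro rfl
      exact h (Finset.mem_Icc.2 ⟨by omega, by omega⟩)
    rw [Matrix.sub_apply, hA k l h, Matrix.one_apply_ne hkl, sub_zero]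
  refine (denseRange_linearCombination e).induction_on
    (p := fun x => (1 - r) * ‖x‖ ^ 2 ≤ (⟪x, R x⟫_ℂ).re) x ?_ fun v => ?_
  · exact isClosed_le (by fun_prop) (by fun_prop)
  let J := Finsupp.linearCombination ℂ e
  -- The matrix of `1 - R` is `A`, so `‖J v‖ ^ 2 - re ⟪J v, R (J v)⟫` is at most `r * ‖J v‖ ^ 2`.
  have h := norm_inner_le_of_forall_fieldOfValues e A
    ((1 - R : H →L[ℂ] H).toLinearMap ∘ₗ J) (fun k l => ?_) r M₀ hW v
  · have hsub : ⟪J v, ((1 - R : H →L[ℂ] H).toLinearMap ∘ₗ J) v⟫_ℂ =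
        (‖J v‖ : ℂ) ^ 2 - ⟪J v, R (J v)⟫_ℂ := by
      have hself : ⟪J v, J v⟫_ℂ = (‖J v‖ : ℂ) ^ 2 := inner_self_eq_norm_sq_to_K _
      rw [← hself, ← inner_sub_right]
      rfl
    rw [hsub] at h
    have hre := (Complex.re_le_norm _).trans h
    rw [Complex.sub_re, ← Complex.ofReal_pow, Complex.ofReal_re] at hre
    linarith
  · have hR' := inner_sum_smul_of_banded e w (1 - A) hbanded k l
    rw [← hR l, Matrix.sub_apply, Matrix.one_apply] at hR'
    simp only [LinearMap.comp_apply, J, Finsupp.linearCombination_single, one_smul,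
      ContinuousLinearMap.coe_coe, sub_apply, one_apply_eq_self,
      inner_sub_right, hR', orthonormal_iff_ite.1 e.orthonormal]
    ring

/-- A coercive operator on a Hilbert space is invertible. -/
theorem isUnit_of_le_re_inner [CompleteSpace H] (R : H →L[ℂ] H) {c : ℝ} (hc : 0 < c)
    (h : ∀ x, c * ‖x‖ ^ 2 ≤ (⟪x, R x⟫_ℂ).re) : IsUnit R := by
  refine ContinuousLinearMap.isUnit_of_forall_le_norm_inner_map R (c := ⟨c, hc.le⟩) hc fun x => ?_
  rw [norm_inner_symm, mul_comm]
  exact (h x).trans (Complex.re_le_norm _)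

/-! ### Convergence of the finite section method. -/

theorem inner_sectionProj_right (e : HilbertBasis ℕ ℂ H) (M : ℕ) {z : H}
    (hz : z ∈ sectionSpace e M) (y : H) : ⟪z, sectionProj e M y⟫_ℂ = ⟪z, y⟫_ℂ := by
  rw [sectionProj, ← Submodule.inner_starProjection_left_eq_right,
    Submodule.starProjection_eq_self_iff.2 hz]

theorem sectionOperator_apply_of_mem (e : HilbertBasis ℕ ℂ H) (M : ℕ) (R : H →L[ℂ] H) {z : H}
    (hz : z ∈ sectionSpace e M) : sectionOperator e M R z = sectionProj e M (R z) := by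
  have : sectionProj e M z = z := Submodule.starProjection_eq_self_iff.2 hz
  simp [sectionOperator, this]

/-- The finite sections of a coercive operator are uniquely solvable. -/
theorem existsUnique_sectionOperator_eq (e : HilbertBasis ℕ ℂ H) (M : ℕ) (R : H →L[ℂ] H) {c : ℝ}
    (hc : 0 < c) (h : ∀ x, c * ‖x‖ ^ 2 ≤ (⟪x, R x⟫_ℂ).re) (y : H) :
    ∃! z : H, z ∈ sectionSpace e M ∧ sectionOperator e M R z = sectionProj e M y := by
  let L : sectionSpace e M →ₗ[ℂ] sectionSpace e M :=
    ((sectionOperator e M R).toLinearMap ∘ₗ (sectionSpace e M).subtype).codRestrict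
      (sectionSpace e M) fun z => Submodule.starProjection_apply_mem _ _
  have hL : ∀ z : sectionSpace e M, (L z : H) = sectionOperator e M R z := fun z => rfl
  -- For `z` in the section space `⟪z, P_M R z⟫ = ⟪z, R z⟫`, so the compression stays coercive; in
  -- finite dimension injectivity suffices.
  have hinj : Function.Injective L := by
    rw [← LinearMap.ker_eq_bot, LinearMap.ker_eq_bot']
    intro z hz
    have h0 : sectionProj e M (R z) = 0 := by
      rw [← sectionOperator_apply_of_mem e M R z.2, ← hL, hz]
      rfl
    have h1 := h z
    rw [← inner_sectionProj_right e M z.2, h0, inner_zero_right, Complex.zero_re] at h1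
    have h2 : ‖(z : H)‖ ^ 2 = 0 := le_antisymm (by nlinarith) (sq_nonneg _)
    simpa using h2
  obtain ⟨z, hz⟩ := LinearMap.surjective_of_injective hinj
    ⟨sectionProj e M y, Submodule.starProjection_apply_mem _ _⟩
  refine ⟨z, ⟨z.2, by rw [← hL, hz]⟩, fun z' ⟨hz', hz''⟩ => ?_⟩
  have : (⟨z', hz'⟩ : sectionSpace e M) = z := hinj (by
    rw [hz]
    exact Subtype.ext hz'')
  rw [← this]

theorem tendsto_sectionProj (e : HilbertBasis ℕ ℂ H) (x : H) :
    Filter.Tendsto (fun M => sectionProj e M x) Filter.atTop (nhds x) := by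
  refine Submodule.starProjection_tendsto_self (sectionSpace e) ?_ x ?_
  · intro m n hmn
    refine Submodule.span_mono ?_
    rintro _ ⟨i, rfl⟩
    exact ⟨⟨i, i.2.trans_le hmn⟩, rfl⟩
  · rw [← e.dense_span]
    refine Submodule.topologicalClosure_mono (Submodule.span_le.2 ?_)
    rintro _ ⟨i, rfl⟩
    exact Submodule.mem_iSup_of_mem (i + 1) (Submodule.subset_span ⟨⟨i, i.lt_succ_self⟩, rfl⟩)

/-- Quasi-optimality of the finite section method for a coercive operator. -/
theorem norm_sub_sectionProj_le (e : HilbertBasis ℕ ℂ H) (M : ℕ) (R : H →L[ℂ] H) {c : ℝ}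
    (hc : 0 < c) (h : ∀ x, c * ‖x‖ ^ 2 ≤ (⟪x, R x⟫_ℂ).re) (x z : H) (hz : z ∈ sectionSpace e M)
    (hRz : sectionOperator e M R z = sectionProj e M (R x)) :
    ‖z - sectionProj e M x‖ ≤ ‖R‖ / c * ‖x - sectionProj e M x‖ := by
  set p := sectionProj e M x
  have hmem : z - p ∈ sectionSpace e M :=
    Submodule.sub_mem _ hz (Submodule.starProjection_apply_mem _ _)
  -- Galerkin orthogonality: `R z - R x` is orthogonal to the section space.
  have hinner : ⟪z - p, R (z - p)⟫_ℂ = ⟪z - p, R (x - p)⟫_ℂ := by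
    rw [map_sub, map_sub, inner_sub_right, inner_sub_right, ← inner_sectionProj_right e M hmem (R z),
      ← inner_sectionProj_right e M hmem (R x), ← hRz, sectionOperator_apply_of_mem e M R hz]
  have h1 : c * ‖z - p‖ ^ 2 ≤ ‖z - p‖ * (‖R‖ * ‖x - p‖) := by
    refine (h _).trans ?_
    rw [hinner]
    exact (Complex.re_le_norm _).trans ((norm_inner_le_norm _ _).trans
      (mul_le_mul_of_nonneg_left (R.le_opNorm _) (norm_nonneg _)))
  rw [div_mul_eq_mul_div, le_div_iff₀ hc]
  rcases (norm_nonneg (z - p)).eq_or_lt with h0 | h0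
  · rw [← h0, zero_mul]
    positivity
  · nlinarith

theorem tendsto_of_sectionOperator_eq (e : HilbertBasis ℕ ℂ H) (R : H →L[ℂ] H) {c : ℝ}
    (hc : 0 < c) (h : ∀ x, c * ‖x‖ ^ 2 ≤ (⟪x, R x⟫_ℂ).re) (x : H) (M₀ : ℕ) (u : ℕ → H)
    (hu : ∀ M > M₀, u M ∈ sectionSpace e M ∧
      sectionOperator e M R (u M) = sectionProj e M (R x)) :
    Filter.Tendsto u Filter.atTop (nhds x) := by
  have hp := tendsto_sectionProj e x
  have hd : Filter.Tendsto (fun M => ‖R‖ / c * ‖x - sectionProj e M x‖) Filter.atTop (nhds 0) := by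
    simpa using ((tendsto_const_nhds (x := x)).sub hp).norm.const_mul (‖R‖ / c)
  have hs : Filter.Tendsto (fun M => u M - sectionProj e M x) Filter.atTop (nhds 0) := by
    refine squeeze_zero_norm' ?_ hd
    filter_upwards [Filter.eventually_gt_atTop M₀] with M hM
    exact norm_sub_sectionProj_le e M R hc h x _ (hu M hM).1 (hu M hM).2
  simpa using hs.add hp

end LegendreStar

theorem mainTheorem4 {H : Type*} [NormedAddCommGroup H] [InnerProductSpace ℂ H] [CompleteSpace H]
    (e : HilbertBasis ℕ ℂ H)
    (f : ℝ → ℂ) (hf : AnalyticOn ℝ f (Set.Icc (-1) 1)) (N : ℕ)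
    (r : ℝ) (hr : r < 1) (M₀ : ℕ)
    (hW : ∀ M > M₀,
      LegendreStar.fieldOfValues
        (LegendreStar.finiteSection (LegendreStar.bandedCoeffMatrix f N) M) ⊆
          Metric.closedBall (0 : ℂ) r) :
    (∃! R : H →L[ℂ] H,
      LegendreStar.IsBandedOperator e (N + 1) (1 - LegendreStar.bandedCoeffMatrix f N) R) ∧
    ∀ R : H →L[ℂ] H,
      LegendreStar.IsBandedOperator e (N + 1) (1 - LegendreStar.bandedCoeffMatrix f N) R →
      IsUnit R ∧
      ∀ x y : H, R x = y →
        (∀ M > M₀, ∃! z : H, z ∈ LegendreStar.sectionSpace e M ∧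
          LegendreStar.sectionOperator e M R z = LegendreStar.sectionProj e M y) ∧
        ∀ u : ℕ → H,
          (∀ M > M₀, u M ∈ LegendreStar.sectionSpace e M ∧
            LegendreStar.sectionOperator e M R (u M) = LegendreStar.sectionProj e M y) →
          Filter.Tendsto u Filter.atTop (nhds x) := by
  have hA := LegendreStar.bandedCoeffMatrix_eq_zero f N
  have hc : 0 < 1 - r := sub_pos.2 hr
  refine ⟨?_, fun R hR => ?_⟩
  · obtain ⟨T, hT⟩ := LegendreStar.exists_isBandedOperator e (N + 1) _ hA M₀
      fun M hM => (hW M hM).trans (Metric.closedBall_subset_closedBall hr.le)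
    refine ⟨1 - T, fun l => ?_, fun S hS => hS.unique fun l => ?_⟩
    all_goals
      -- The diagonal lies in the band, so the identity matrix contributes exactly `e l`.
      have hl : l ∈ Finset.Icc (l - (N + 1)) (l + (N + 1)) :=
        Finset.mem_Icc.2 ⟨by omega, by omega⟩
      simp [hT l, Matrix.sub_apply, Matrix.one_apply, sub_smul, Finset.sum_sub_distrib, ite_smul]
  · have hcoer := hR.le_re_inner hA hW
    refine ⟨LegendreStar.isUnit_of_le_re_inner R hc hcoer, ?_⟩
    rintro x _ rfl
    exact ⟨fun M _ => LegendreStar.existsUnique_sectionOperator_eq e M R hc hcoer (R x),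
      fun u hu => LegendreStar.tendsto_of_sectionOperator_eq e R hc hcoer x M₀ u hu⟩
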